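/- Conventions. A (concrete) operator space is a closed subspace $X$ of $B(H)$, $H$ a complex Hilbert space; $M_n(X)$ carries the norm inherited from $M_n(B(H)) = B(H\oplus_2\cdots\oplus_2 H)$. A linear map $u : X \to Y$ is completely bounded if $\sup_n \|I_{M_n}\otimes u : M_n(X)\to M_n(Y)\| < \infty$. $X$ and $Y$ are completely isomorphic if there is a completely bounded linear bijection $u : X\to Y$ with completely bounded inverse; $X$ embeds completely isomorphically into $Y$ if $X$ is completely isomorphic to a closed subspace of $Y$. Let $\mathbf{R}$ and $\mathbf{C}$ be the row and column operator spaces, i.e. $\ell_2$ realised in $B(\ell_2)$ by $\xi\mapsto\sum_j \xi_j E_{1j}$ and $\xi\mapsto\sum_i\xi_i E_{i1}$ respectively, and let $\mathbf{R}\oplus\mathbf{C}\subset B(\ell_2\oplus_2\ell_2)$. For a sequence $\alpha=(\alpha_i)_{i\in\mathbb N}$ in $[0,1]$ let $$X^d(\alpha)=\{(\xi,\operatorname{diag}(\alpha)\xi):\xi\in\ell_2\}\subset\mathbf{R}\oplus\mathbf{C}.$$ Let $\mathcal S$ be the set of sequences with $1\ge\alpha_1\ge\alpha_2\ge\dots\ge0$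 and $\lim_i\alpha_i=0$. For $\alpha,\beta\in\mathcal S$ write $\alpha\prec\beta$ (equivalently $\beta\succ\alpha$) if there are a set $S\subset\mathbb N$ and a constant $K>0$ such that $\sum_{i\in S}\alpha_i^2<\infty$ and $\alpha_i\le K\beta_i$ for all $i\notin S$. Write $\alpha\sim\beta$ if $\alpha\prec\beta$ and $\beta\prec\alpha$. Theorem. Let $\alpha,\beta\in\mathcal S$. Then $X^d(\alpha)$ embeds completely isomorphically into $X^d(\beta)$ if and only if $\alpha\prec\beta$. Moreover, the following are equivalent: 1. $X^d(\alpha)$ is completely isomorphic to $X^d(\beta)$; 2. $X^d(\alpha)$ embeds completely isomorphically into $X^d(\beta)$, and $X^d(\beta)$ embeds completely isomorphically into $X^d(\alpha)$; 3. $\alpha\sim\beta$. -/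

import Mathlib

open Filter Topology

/-- A concrete operator space: a closed subspace of `B(H)`, for a Hilbert space `H`. -/
abbrev OperatorSpace (H : Type*) [NormedAddCommGroup H] [InnerProductSpace ℂ H] : Type _ :=
  ClosedSubmodule ℂ (H →L[ℂ] H)

namespace OperatorSpace

section General

variable {H K : Type*} [NormedAddCommGroup H] [InnerProductSpace ℂ H]
  [NormedAddCommGroup K] [InnerProductSpace ℂ K]

/-- The operator on the `ℓ₂`-direct sum of `n` copies of `H` given by an `n × n` matrix of
operators: `(blockOp v x) i = ∑ j, v i j (x j)`. -/
noncomputable def blockOp {n : ℕ} (v : Matrix (Fin n) (Fin n) (H →L[ℂ] H)) :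
    PiLp 2 (fun _ : Fin n => H) →L[ℂ] PiLp 2 (fun _ : Fin n => H) :=
  (PiLp.continuousLinearEquiv 2 ℂ (fun _ : Fin n => H)).symm.toContinuousLinearMap ∘L
    ContinuousLinearMap.pi (fun i =>
      ∑ j, (v i j) ∘L PiLp.proj (𝕜 := ℂ) 2 (fun _ : Fin n => H) j)

theorem blockOp_apply {n : ℕ} (v : Matrix (Fin n) (Fin n) (H →L[ℂ] H))
    (x : PiLp 2 (fun _ : Fin n => H)) (i : Fin n) : blockOp v x i = ∑ j, v i j (x j) := by
  simp [blockOp]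

/-- The norm of `M_n(X)`, inherited from `M_n(B(H)) = B(H ⊕₂ ⋯ ⊕₂ H)`. -/
noncomputable def matNorm (X : OperatorSpace H) {n : ℕ}
    (v : Matrix (Fin n) (Fin n) X.toSubmodule) : ℝ :=
  ‖blockOp (v.map (fun x => (x : H →L[ℂ] H)))‖

/-- A linear map `u : X → Y` is completely bounded if the norms of its amplifications
`M_n(X) → M_n(Y)`, which apply `u` entrywise, are bounded uniformly in `n`. -/
def CompletelyBounded (X : OperatorSpace H) (Y : OperatorSpace K)
    (u : X.toSubmodule →ₗ[ℂ] Y.toSubmodule) : Prop :=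
  ∃ C : ℝ, ∀ (n : ℕ) (v : Matrix (Fin n) (Fin n) X.toSubmodule),
    matNorm Y (v.map u) ≤ C * matNorm X v

/-- `X` and `Y` are completely isomorphic: there is a completely bounded linear bijection
`X → Y` with completely bounded inverse. -/
def CompletelyIsomorphic (X : OperatorSpace H) (Y : OperatorSpace K) : Prop :=
  ∃ u : X.toSubmodule ≃ₗ[ℂ] Y.toSubmodule,
    CompletelyBounded X Y u.toLinearMap ∧ CompletelyBounded Y X u.symm.toLinearMap

/-- `X` embeds completely isomorphically into `Y`: it is completely isomorphic to a (closed)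
subspace of `Y`. -/
def CompletelyEmbeds (X : OperatorSpace H) (Y : OperatorSpace K) : Prop :=
  ∃ Z : OperatorSpace K, Z ≤ Y ∧ CompletelyIsomorphic X Z

/-- The direct sum of two operators, acting on the Hilbert space `H ⊕₂ K`. -/
noncomputable def dirSum (S : H →L[ℂ] H) (T : K →L[ℂ] K) :
    WithLp 2 (H × K) →L[ℂ] WithLp 2 (H × K) :=
  (WithLp.prodContinuousLinearEquiv 2 ℂ H K).symm.toContinuousLinearMap ∘L
    (S.prodMap T) ∘L (WithLp.prodContinuousLinearEquiv 2 ℂ H K).toContinuousLinearMap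

end General

/-- The complex Hilbert space `ℓ₂` of square-summable sequences indexed by `ℕ`. -/
abbrev Ell2 : Type := lp (fun _ : ℕ => ℂ) 2

/-- The row operator `∑ j, ξ j • E_{0j}` of `ξ`, that is `ζ ↦ (∑ j, ξ j * ζ j) e₀`. The space `R`
consists of these operators. (The inner product is conjugate-linear in its first argument.) -/
noncomputable def rowOp (ξ : Ell2) : Ell2 →L[ℂ] Ell2 :=
  (innerSL ℂ (star ξ)).smulRight (lp.single 2 0 (1 : ℂ))

/-- The column operator `∑ i, ξ i • E_{i0}` of `ξ`, that is `ζ ↦ ζ 0 • ξ`. The space `C` consists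
of these operators. -/
noncomputable def colOp (ξ : Ell2) : Ell2 →L[ℂ] Ell2 :=
  (innerSL ℂ (lp.single 2 0 (1 : ℂ) : Ell2)).smulRight ξ

theorem rowOp_apply (ξ ζ : Ell2) : rowOp ξ ζ = (∑' j, ξ j * ζ j) • lp.single 2 0 (1 : ℂ) := by
  simp [rowOp, lp.inner_eq_tsum, mul_comm]

theorem colOp_apply (ξ ζ : Ell2) : colOp ξ ζ = ζ 0 • ξ := by
  simp [colOp, lp.inner_single_left]

/-- The linear map `ξ ↦ (ξ, A ξ)` from `ℓ₂` to `R ⊕ C ⊆ B(ℓ₂ ⊕₂ ℓ₂)`. -/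
noncomputable def graphMap (A : Ell2 →L[ℂ] Ell2) :
    Ell2 →ₗ[ℂ] (WithLp 2 (Ell2 × Ell2) →L[ℂ] WithLp 2 (Ell2 × Ell2)) where
  toFun ξ := dirSum (rowOp ξ) (colOp (A ξ))
  map_add' ξ η := by
    ext x : 1
    apply (WithLp.equiv 2 _).injective
    ext1
    · simp [dirSum, rowOp, add_smul]
    · simp [dirSum, colOp]
  map_smul' c ξ := by
    ext x : 1
    apply (WithLp.equiv 2 _).injective
    ext1
    · simp [dirSum, rowOp, mul_smul]
    · simp [dirSum, colOp, smul_comm c]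

theorem norm_le_norm_graphMap (A : Ell2 →L[ℂ] Ell2) (ξ : Ell2) : ‖ξ‖ ≤ ‖graphMap A ξ‖ := by
  have hrow : ‖rowOp ξ‖ = ‖ξ‖ := by simp [rowOp]
  rw [← hrow]
  refine ContinuousLinearMap.opNorm_le_bound _ (norm_nonneg _) fun ζ => ?_
  have h := (graphMap A ξ).le_opNorm (WithLp.toLp 2 (ζ, 0))
  have h1 : graphMap A ξ (WithLp.toLp 2 (ζ, 0)) = WithLp.toLp 2 (rowOp ξ ζ, 0) := by
    apply (WithLp.equiv 2 _).injective
    ext1 <;> simp [graphMap, dirSum]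
  simpa [h1] using h

theorem continuous_graphMap (A : Ell2 →L[ℂ] Ell2) : Continuous (graphMap A) := by
  have hrow (ξ : Ell2) : ‖rowOp ξ‖ = ‖ξ‖ := by simp [rowOp]
  have hcol (ξ : Ell2) : ‖colOp ξ‖ = ‖ξ‖ := by simp [colOp]
  refine AddMonoidHomClass.continuous_of_bound (graphMap A) (1 + ‖A‖) fun ξ => ?_
  refine ContinuousLinearMap.opNorm_le_bound _ (by positivity) fun x => ?_
  have h1 : graphMap A ξ x =
      WithLp.toLp 2 (rowOp ξ x.fst, 0) + WithLp.toLp 2 (0, colOp (A ξ) x.snd) := by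
    apply (WithLp.equiv 2 _).injective
    ext1 <;> simp [graphMap, dirSum]
  have h2 : ‖rowOp ξ x.fst‖ ≤ ‖ξ‖ * ‖x‖ :=
    ((rowOp ξ).le_opNorm _).trans
      (by rw [hrow]; gcongr; exact WithLp.norm_fst_le _ x)
  have h3 : ‖colOp (A ξ) x.snd‖ ≤ ‖A‖ * ‖ξ‖ * ‖x‖ :=
    ((colOp (A ξ)).le_opNorm _).trans
      (by rw [hcol]; gcongr; exacts [A.le_opNorm _, WithLp.norm_snd_le _ x])
  rw [h1]
  refine (norm_add_le _ _).trans ?_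
  simp only [WithLp.norm_toLp_fst, WithLp.norm_toLp_snd]
  linarith

theorem isClosed_range_graphMap (A : Ell2 →L[ℂ] Ell2) :
    IsClosed (LinearMap.range (graphMap A) :
      Set (WithLp 2 (Ell2 × Ell2) →L[ℂ] WithLp 2 (Ell2 × Ell2))) := by
  have h : AntilipschitzWith 1 (graphMap A) :=
    AddMonoidHomClass.antilipschitz_of_bound (graphMap A) fun ξ => by
      simpa using norm_le_norm_graphMap A ξ
  have hu : UniformContinuous (graphMap A) :=
    uniformContinuous_addMonoidHom_of_continuous (continuous_graphMap A)
  rw [LinearMap.coe_range]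
  exact h.isClosed_range hu

/-- The operator space `X(A) = {(ξ, A ξ) : ξ ∈ ℓ₂} ⊆ R ⊕ C`. -/
noncomputable def graphSpace (A : Ell2 →L[ℂ] Ell2) : OperatorSpace (WithLp 2 (Ell2 × Ell2)) where
  toSubmodule := LinearMap.range (graphMap A)
  isClosed' := isClosed_range_graphMap A

/-- The diagonal operator on `ℓ₂` with diagonal `α`. -/
noncomputable def diagOp (α : ℕ → unitInterval) : Ell2 →L[ℂ] Ell2 :=
  lp.mapCLM 2 (fun i => ((α i : ℝ) : ℂ) • ContinuousLinearMap.id ℂ ℂ) zero_le_one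
    (fun i => by simpa [norm_smul, abs_of_nonneg (α i).2.1] using (α i).2.2)

theorem diagOp_apply (α : ℕ → unitInterval) (ξ : Ell2) (i : ℕ) :
    diagOp α ξ i = ((α i : ℝ) : ℂ) * ξ i := by
  simp [diagOp]

/-- The operator space `X^d(α) = X(diag α)`. -/
noncomputable def diagSpace (α : ℕ → unitInterval) : OperatorSpace (WithLp 2 (Ell2 × Ell2)) :=
  graphSpace (diagOp α)

end OperatorSpace

/-- The set of non-increasing sequences in `[0, 1]` that converge to `0`. -/
def nullSequences : Set (ℕ → unitInterval) :=
  {α | Antitone α ∧ Tendsto (fun i => (α i : ℝ)) atTop (𝓝 0)}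

/-- `α ≺ β`: off a set `S` on which `α` is square-summable, `α` is bounded by a constant
multiple of `β`. -/
def SeqDominated (α β : ℕ → unitInterval) : Prop :=
  ∃ (S : Set ℕ) (K : ℝ), 0 < K ∧ Summable (fun i : S => (α i : ℝ) ^ 2) ∧
    ∀ i ∉ S, (α i : ℝ) ≤ K * (β i : ℝ)

/-- `α ∼ β`: each of the two sequences dominates the other. -/
def SeqEquiv (α β : ℕ → unitInterval) : Prop :=
  SeqDominated β α ∧ SeqDominated α β

/-!
The row-to-column completely bounded norm on `ℓ₂` is controlled by the Hilbert-Schmidt norm, and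
the norm on `M_n(X(A))` is the maximum of the row norm of a matrix and the column norm of its image
under `A`. Hence an operator `T` with a left inverse induces a complete embedding `X(A) → X(B)` as
soon as `A - B ∘ T` is Hilbert-Schmidt. If `α ≺ β`, then `diag α = diag β ∘ G` modulo
Hilbert-Schmidt operators, where `G` is diagonal with entries `α i / β i` off the exceptional set
and `0` on it. Such a `G` need not be bounded below, so we set it to `0` also on a subsequence
along which `β` is square-summable and add an isometry of `ℓ₂` onto the coordinates of that
subsequence; this changes `diag β ∘ G` by a Hilbert-Schmidt operator only and makes `G` left
invertible.

Conversely, placing an orthonormal family `g` in a single matrix column shows that a complete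
embedding yields, after rescaling, an operator `T` with
`∑ ‖A (g i)‖² ≤ ‖T‖² + ∑ ‖B (T (g i))‖²`. When `A` and `B` are diagonal with non-increasing entries
`α i` and `β i`, restrict to the first `n` coordinates and take for `g` the eigenvectors with
positive eigenvalue of the difference of the two quadratic forms. The positive part of this
difference then has trace at most `‖T‖²`, and so do, by the min-max principle, all partial sums of
the differences of ordered eigenvalues. These differences are at least `α i ^ 2 - ‖T‖² β i ^ 2`, so
`α` is square-summable over the indices with `2 ‖T‖² β i ^ 2 < α i ^ 2`.
-/

section Eigenvalues

open Module InnerProductSpace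

theorem exists_ne_zero_forall_gt_apply_eq_zero_forall_lt_apply_eq_zero {k V : Type*} [Field k]
    [AddCommGroup V] [Module k V] {n : ℕ} (hn : finrank k V = n)
    (φ ψ : V →ₗ[k] Fin n → k) (i : Fin n) :
    ∃ x ≠ 0, (∀ j, i < j → φ x j = 0) ∧ ∀ j < i, ψ x j = 0 := by
  let θ : V →ₗ[k] {j : Fin n // j ≠ i} → k := LinearMap.pi fun j =>
    if i < j then LinearMap.proj j.1 ∘ₗ φ else LinearMap.proj j.1 ∘ₗ ψ
  have hlt : finrank k ({j : Fin n // j ≠ i} → k) < finrank k V := by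
    rw [finrank_fintype_fun_eq_card, hn]
    simpa using Fintype.card_subtype_lt (p := fun j => j ≠ i) (x := i) (by simp)
  have : Module.Finite k V := finite_of_finrank_pos (hn ▸ i.pos)
  obtain ⟨x, hx, hx0⟩ := Submodule.exists_mem_ne_zero_of_ne_bot
    (LinearMap.ker_ne_bot_of_finrank_lt (f := θ) hlt)
  refine ⟨x, hx0, fun j hj => ?_, fun j hj => ?_⟩
  · simpa [θ, hj] using congrFun hx ⟨j, hj.ne'⟩
  · simpa [θ, hj.not_gt] using congrFun hx ⟨j, hj.ne⟩

variable {𝕜 E : Type*} [RCLike 𝕜] [NormedAddCommGroup E] [InnerProductSpace 𝕜 E]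
  [FiniteDimensional 𝕜 E] {n : ℕ} {S T : E →ₗ[𝕜] E}

theorem re_inner_apply_self_eq_sum_eigenvalues_mul (hT : T.IsSymmetric) (hn : finrank 𝕜 E = n)
    (x : E) : RCLike.re ⟪T x, x⟫_𝕜 =
      ∑ j, hT.eigenvalues hn j * ‖(hT.eigenvectorBasis hn).repr x j‖ ^ 2 := by
  rw [← (hT.eigenvectorBasis hn).repr.inner_map_map, PiLp.inner_apply, map_sum]
  refine Finset.sum_congr rfl fun j _ => ?_
  rw [hT.eigenvectorBasis_apply_self_apply, ← smul_eq_mul, inner_smul_left, RCLike.conj_ofReal,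
    inner_self_eq_norm_sq_to_K, ← RCLike.ofReal_pow, ← RCLike.ofReal_mul, RCLike.ofReal_re]

theorem re_inner_apply_self_le_eigenvalues_mul (hT : T.IsSymmetric) (hn : finrank 𝕜 E = n)
    {i : Fin n} {x : E} (hx : ∀ j < i, (hT.eigenvectorBasis hn).repr x j = 0) :
    RCLike.re ⟪T x, x⟫_𝕜 ≤ hT.eigenvalues hn i * ‖x‖ ^ 2 := by
  rw [re_inner_apply_self_eq_sum_eigenvalues_mul hT hn, ← (hT.eigenvectorBasis hn).repr.norm_map x,
    EuclideanSpace.norm_sq_eq, Finset.mul_sum]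
  refine Finset.sum_le_sum fun j _ => ?_
  rcases lt_or_ge j i with hj | hj
  · simp [hx j hj]
  · gcongr
    exact hT.eigenvalues_antitone hn hj

theorem eigenvalues_mul_le_re_inner_apply_self (hT : T.IsSymmetric) (hn : finrank 𝕜 E = n)
    {i : Fin n} {x : E} (hx : ∀ j, i < j → (hT.eigenvectorBasis hn).repr x j = 0) :
    hT.eigenvalues hn i * ‖x‖ ^ 2 ≤ RCLike.re ⟪T x, x⟫_𝕜 := by
  rw [re_inner_apply_self_eq_sum_eigenvalues_mul hT hn, ← (hT.eigenvectorBasis hn).repr.norm_map x,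
    EuclideanSpace.norm_sq_eq, Finset.mul_sum]
  refine Finset.sum_le_sum fun j _ => ?_
  rcases lt_or_ge i j with hj | hj
  · simp [hx j hj]
  · gcongr
    exact hT.eigenvalues_antitone hn hj

theorem le_eigenvalues_of_forall_mul_le_re_inner (hT : T.IsSymmetric) (hn : finrank 𝕜 E = n)
    {i : Fin n} {c : ℝ} (φ : E →ₗ[𝕜] Fin n → 𝕜)
    (h : ∀ x, (∀ j, i < j → φ x j = 0) → c * ‖x‖ ^ 2 ≤ RCLike.re ⟪T x, x⟫_𝕜) :
    c ≤ hT.eigenvalues hn i := by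
  obtain ⟨x, hx0, hgt, hlt⟩ :=
    exists_ne_zero_forall_gt_apply_eq_zero_forall_lt_apply_eq_zero hn φ
      ((WithLp.linearEquiv 2 𝕜 _).toLinearMap ∘ₗ (hT.eigenvectorBasis hn).repr.toLinearMap) i
  exact le_of_mul_le_mul_right
    ((h x hgt).trans (re_inner_apply_self_le_eigenvalues_mul hT hn hlt)) (by positivity)

theorem eigenvalues_le_of_forall_re_inner_le_mul (hT : T.IsSymmetric) (hn : finrank 𝕜 E = n)
    {i : Fin n} {c : ℝ} (φ : E →ₗ[𝕜] Fin n → 𝕜)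
    (h : ∀ x, (∀ j < i, φ x j = 0) → RCLike.re ⟪T x, x⟫_𝕜 ≤ c * ‖x‖ ^ 2) :
    hT.eigenvalues hn i ≤ c := by
  obtain ⟨x, hx0, hgt, hlt⟩ :=
    exists_ne_zero_forall_gt_apply_eq_zero_forall_lt_apply_eq_zero hn
      ((WithLp.linearEquiv 2 𝕜 _).toLinearMap ∘ₗ (hT.eigenvectorBasis hn).repr.toLinearMap) φ i
  exact le_of_mul_le_mul_right
    ((eigenvalues_mul_le_re_inner_apply_self hT hn hgt).trans (h x hlt)) (by positivity)

theorem eigenvalues_mono (hS : S.IsSymmetric) (hT : T.IsSymmetric) (hn : finrank 𝕜 E = n)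
    (h : S ≤ T) (i : Fin n) : hS.eigenvalues hn i ≤ hT.eigenvalues hn i := by
  refine le_eigenvalues_of_forall_mul_le_re_inner hT hn
    ((WithLp.linearEquiv 2 𝕜 _).toLinearMap ∘ₗ (hS.eigenvectorBasis hn).repr.toLinearMap)
    fun x hx => (eigenvalues_mul_le_re_inner_apply_self hS hn hx).trans ?_
  simpa [inner_sub_left] using ((LinearMap.le_def S T).1 h).re_inner_nonneg_left x

theorem sum_eigenvalues_sub_le_re_trace (hS : S.IsSymmetric) (hT : T.IsSymmetric)
    (hn : finrank 𝕜 E = n) {P : E →ₗ[𝕜] E} (hP : P.IsPositive) (hSTP : S ≤ T + P)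
    (s : Finset (Fin n)) :
    ∑ i ∈ s, (hS.eigenvalues hn i - hT.eigenvalues hn i) ≤ RCLike.re (LinearMap.trace 𝕜 E P) := by
  have hTP : (T + P).IsSymmetric := hT.add hP.isSymmetric
  have hT_le : T ≤ T + P := le_add_of_nonneg_right (P.nonneg_iff_isPositive.2 hP)
  calc ∑ i ∈ s, (hS.eigenvalues hn i - hT.eigenvalues hn i)
      ≤ ∑ i ∈ s, (hTP.eigenvalues hn i - hT.eigenvalues hn i) := by
        gcongr with i
        exact eigenvalues_mono hS hTP hn hSTP i
    _ ≤ ∑ i, (hTP.eigenvalues hn i - hT.eigenvalues hn i) :=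
        Finset.sum_le_univ_sum_of_nonneg fun i =>
          sub_nonneg.2 (eigenvalues_mono hT hTP hn hT_le i)
    _ = RCLike.re (LinearMap.trace 𝕜 E P) := by
        rw [Finset.sum_sub_distrib, ← hTP.re_trace_eq_sum_eigenvalues,
          ← hT.re_trace_eq_sum_eigenvalues, map_add, map_add, add_sub_cancel_left]

theorem eq_sum_eigenvalues_smul_rankOne (hT : T.IsSymmetric) (hn : finrank 𝕜 E = n) :
    T = ∑ p, (hT.eigenvalues hn p : 𝕜) •
      (rankOne 𝕜 (hT.eigenvectorBasis hn p) (hT.eigenvectorBasis hn p)).toLinearMap := by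
  refine (hT.eigenvectorBasis hn).toBasis.ext fun q => ?_
  simp [LinearMap.sum_apply, OrthonormalBasis.inner_eq_ite]

theorem exists_isPositive_le_re_trace_eq (hT : T.IsSymmetric) (hn : finrank 𝕜 E = n) :
    ∃ P : E →ₗ[𝕜] E, P.IsPositive ∧ T ≤ P ∧
      RCLike.re (LinearMap.trace 𝕜 E P) =
        ∑ p with 0 < hT.eigenvalues hn p, hT.eigenvalues hn p := by
  set d := hT.eigenvalues hn with hd
  set b := hT.eigenvectorBasis hn with hb
  have isPositive_sum_smul {r : Fin n → ℝ} (hr : ∀ p, 0 ≤ r p) :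
      (∑ p, (r p : 𝕜) • (rankOne 𝕜 (b p) (b p)).toLinearMap).IsPositive :=
    LinearMap.isPositive_sum _ fun p _ =>
      LinearMap.IsPositive.smul_of_nonneg
        ((rankOne 𝕜 (b p) (b p)).isPositive_toLinearMap_iff.2 (isPositive_rankOne_self _))
        (RCLike.ofReal_nonneg.2 (hr p))
  refine ⟨∑ p, ((max (d p) 0 : ℝ) : 𝕜) • (rankOne 𝕜 (b p) (b p)).toLinearMap,
    isPositive_sum_smul fun p => le_max_right _ _, ?_, ?_⟩
  · rw [LinearMap.le_def, eq_sum_eigenvalues_smul_rankOne hT hn, ← Finset.sum_sub_distrib]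
    simpa only [hd, hb, ← sub_smul, ← RCLike.ofReal_sub] using
      isPositive_sum_smul fun p => sub_nonneg.2 (le_max_left (d p) 0)
  · rw [map_sum, map_sum, Finset.sum_filter]
    refine Finset.sum_congr rfl fun p _ => ?_
    rw [map_smul, trace_rankOne, b.inner_eq_one, smul_eq_mul, mul_one, RCLike.ofReal_re]
    split_ifs with hp
    exacts [max_eq_left hp.le, max_eq_right (not_lt.1 hp)]

theorem sum_eigenvalues_sub_le_of_orthonormalBasis (hS : S.IsSymmetric) (hT : T.IsSymmetric)
    (hn : finrank 𝕜 E = n) {c : ℝ}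
    (h : ∀ (b : OrthonormalBasis (Fin n) 𝕜 E) (s : Finset (Fin n)),
      ∑ p ∈ s, RCLike.re ⟪S (b p), b p⟫_𝕜 ≤ c + ∑ p ∈ s, RCLike.re ⟪T (b p), b p⟫_𝕜)
    (s : Finset (Fin n)) :
    ∑ i ∈ s, (hS.eigenvalues hn i - hT.eigenvalues hn i) ≤ c := by
  have hD : (S - T).IsSymmetric := hS.sub hT
  obtain ⟨P, hP, hDP, htrace⟩ := exists_isPositive_le_re_trace_eq hD hn
  refine (sum_eigenvalues_sub_le_re_trace hS hT hn hP (sub_le_iff_le_add'.1 hDP) s).trans ?_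
  have eigenvalues_eq (p) : hD.eigenvalues hn p =
      RCLike.re ⟪S (hD.eigenvectorBasis hn p), hD.eigenvectorBasis hn p⟫_𝕜 -
        RCLike.re ⟪T (hD.eigenvectorBasis hn p), hD.eigenvectorBasis hn p⟫_𝕜 := by
    rw [← map_sub, ← inner_sub_left, ← LinearMap.sub_apply, hD.apply_eigenvectorBasis,
      inner_smul_left, OrthonormalBasis.inner_eq_one]
    simp
  rw [htrace, Finset.sum_congr rfl fun p _ => eigenvalues_eq p, Finset.sum_sub_distrib,
    sub_le_iff_le_add]
  exact h _ _

theorem sum_sub_le_of_orthonormalBasis {F G : Type*}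
    [NormedAddCommGroup F] [InnerProductSpace 𝕜 F] [CompleteSpace F]
    [NormedAddCommGroup G] [InnerProductSpace 𝕜 G] [CompleteSpace G]
    (hn : finrank 𝕜 E = n) {A : E →L[𝕜] F} {B : E →L[𝕜] G} {a b : Fin n → ℝ} {c : ℝ}
    (φ ψ : E →ₗ[𝕜] Fin n → 𝕜)
    (hA : ∀ i x, (∀ j, i < j → φ x j = 0) → a i * ‖x‖ ^ 2 ≤ ‖A x‖ ^ 2)
    (hB : ∀ i x, (∀ j < i, ψ x j = 0) → ‖B x‖ ^ 2 ≤ b i * ‖x‖ ^ 2)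
    (h : ∀ (e : OrthonormalBasis (Fin n) 𝕜 E) (s : Finset (Fin n)),
      ∑ p ∈ s, ‖A (e p)‖ ^ 2 ≤ c + ∑ p ∈ s, ‖B (e p)‖ ^ 2)
    (s : Finset (Fin n)) : ∑ i ∈ s, (a i - b i) ≤ c := by
  have : CompleteSpace E := FiniteDimensional.complete 𝕜 E
  have hAA := (ContinuousLinearMap.isPositive_adjoint_comp_self A).isSymmetric
  have hBB := (ContinuousLinearMap.isPositive_adjoint_comp_self B).isSymmetric
  refine le_trans (Finset.sum_le_sum fun i _ => sub_le_sub ?_ ?_)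
    (sum_eigenvalues_sub_le_of_orthonormalBasis hAA hBB hn
      (by simpa only [ContinuousLinearMap.coe_coe,
        ← ContinuousLinearMap.apply_norm_sq_eq_inner_adjoint_left] using h) s)
  · refine le_eigenvalues_of_forall_mul_le_re_inner hAA hn φ fun x hx => (hA i x hx).trans_eq ?_
    exact A.apply_norm_sq_eq_inner_adjoint_left x
  · refine eigenvalues_le_of_forall_re_inner_le_mul hBB hn ψ fun x hx => le_trans ?_ (hB i x hx)
    exact (B.apply_norm_sq_eq_inner_adjoint_left x).ge

end Eigenvalues

namespace OperatorSpace

section BlockOperators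

variable {H K : Type*} [NormedAddCommGroup H] [InnerProductSpace ℂ H]
  [NormedAddCommGroup K] [InnerProductSpace ℂ K] {n : ℕ}

theorem norm_blockOp_apply_sq (v : Matrix (Fin n) (Fin n) (H →L[ℂ] H))
    (x : PiLp 2 (fun _ : Fin n => H)) :
    ‖blockOp v x‖ ^ 2 = ∑ i, ‖∑ j, v i j (x j)‖ ^ 2 := by
  simp only [PiLp.norm_sq_eq_of_L2, blockOp_apply]

theorem sum_norm_sq_le_norm_blockOp (v : Matrix (Fin n) (Fin n) (H →L[ℂ] H)) (x : Fin n → H) :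
    ∑ i, ‖∑ j, v i j (x j)‖ ^ 2 ≤ ‖blockOp v‖ ^ 2 * ∑ j, ‖x j‖ ^ 2 := by
  have h := pow_le_pow_left₀ (norm_nonneg _) ((blockOp v).le_opNorm (WithLp.toLp 2 x)) 2
  rwa [mul_pow, norm_blockOp_apply_sq, PiLp.norm_sq_eq_of_L2] at h

theorem norm_blockOp_le {v : Matrix (Fin n) (Fin n) (H →L[ℂ] H)} {c : ℝ} (hc : 0 ≤ c)
    (h : ∀ x : Fin n → H, ∑ i, ‖∑ j, v i j (x j)‖ ^ 2 ≤ c ^ 2 * ∑ j, ‖x j‖ ^ 2) :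
    ‖blockOp v‖ ≤ c := by
  refine ContinuousLinearMap.opNorm_le_bound _ hc fun x => le_of_sq_le_sq ?_ (by positivity)
  rw [mul_pow, norm_blockOp_apply_sq, PiLp.norm_sq_eq_of_L2]
  exact h x

theorem norm_blockOp_fin_one (v : Matrix (Fin 1) (Fin 1) (H →L[ℂ] H)) :
    ‖blockOp v‖ = ‖v 0 0‖ := by
  refine le_antisymm (norm_blockOp_le (norm_nonneg _) fun x => ?_)
    (ContinuousLinearMap.opNorm_le_bound _ (ContinuousLinearMap.opNorm_nonneg _) fun x => ?_)
  · simpa only [Fin.sum_univ_one, ← mul_pow] using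
      pow_le_pow_left₀ (norm_nonneg _) ((v 0 0).le_opNorm (x 0)) 2
  · refine le_of_sq_le_sq ?_ (by positivity)
    simpa only [Fin.sum_univ_one, mul_pow] using sum_norm_sq_le_norm_blockOp v fun _ => x

theorem norm_blockOp_add_le (v w : Matrix (Fin n) (Fin n) (H →L[ℂ] H)) :
    ‖blockOp (v + w)‖ ≤ ‖blockOp v‖ + ‖blockOp w‖ := by
  have blockOp_add : blockOp (v + w) = blockOp v + blockOp w := by
    ext x i
    simp [blockOp_apply, Finset.sum_add_distrib]
  rw [blockOp_add]
  exact ContinuousLinearMap.opNorm_add_le _ _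

theorem blockOp_conjTranspose [CompleteSpace H] (v : Matrix (Fin n) (Fin n) (H →L[ℂ] H)) :
    blockOp v.conjTranspose = ContinuousLinearMap.adjoint (blockOp v) := by
  refine (ContinuousLinearMap.eq_adjoint_iff _ _).2 fun x y => ?_
  simp only [PiLp.inner_apply, blockOp_apply, sum_inner, inner_sum, Matrix.conjTranspose_apply,
    ContinuousLinearMap.star_eq_adjoint, ContinuousLinearMap.adjoint_inner_left]
  exact Finset.sum_comm

theorem norm_blockOp_conjTranspose [CompleteSpace H] (v : Matrix (Fin n) (Fin n) (H →L[ℂ] H)) :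
    ‖blockOp v.conjTranspose‖ = ‖blockOp v‖ := by
  rw [blockOp_conjTranspose, LinearIsometryEquiv.norm_map]

theorem dirSum_apply (S : H →L[ℂ] H) (T : K →L[ℂ] K) (x : WithLp 2 (H × K)) :
    dirSum S T x = WithLp.toLp 2 (S x.fst, T x.snd) := rfl

theorem norm_sq_sum_dirSum_apply {ι : Type*} (s : Finset ι) (a : ι → H →L[ℂ] H)
    (b : ι → K →L[ℂ] K) (x : ι → WithLp 2 (H × K)) :
    ‖∑ j ∈ s, dirSum (a j) (b j) (x j)‖ ^ 2 =
      ‖∑ j ∈ s, a j (x j).fst‖ ^ 2 + ‖∑ j ∈ s, b j (x j).snd‖ ^ 2 := by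
  have sum_eq : ∑ j ∈ s, dirSum (a j) (b j) (x j) =
      WithLp.toLp 2 (∑ j ∈ s, a j (x j).fst, ∑ j ∈ s, b j (x j).snd) := by
    simp only [dirSum_apply, ← WithLp.toLp_sum]
    congr 1
    ext <;> simp [Prod.fst_sum, Prod.snd_sum]
  rw [sum_eq, WithLp.prod_norm_sq_eq_of_L2]
  rfl

theorem norm_blockOp_dirSum (a : Matrix (Fin n) (Fin n) (H →L[ℂ] H))
    (b : Matrix (Fin n) (Fin n) (K →L[ℂ] K)) :
    ‖blockOp (fun i j => dirSum (a i j) (b i j))‖ = max ‖blockOp a‖ ‖blockOp b‖ := by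
  have ha := ContinuousLinearMap.opNorm_nonneg (blockOp a)
  have hb := ContinuousLinearMap.opNorm_nonneg (blockOp b)
  have hab := ContinuousLinearMap.opNorm_nonneg (blockOp fun i j => dirSum (a i j) (b i j))
  refine le_antisymm (norm_blockOp_le (ha.trans (le_max_left _ _)) fun x => ?_)
    (max_le (norm_blockOp_le hab fun x => ?_) (norm_blockOp_le hab fun x => ?_))
  · have h1 := sum_norm_sq_le_norm_blockOp a fun j => (x j).fst
    have h2 := sum_norm_sq_le_norm_blockOp b fun j => (x j).snd
    simp only [norm_sq_sum_dirSum_apply Finset.univ, WithLp.prod_norm_sq_eq_of_L2,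
      Finset.sum_add_distrib, mul_add]
    refine add_le_add (h1.trans ?_) (h2.trans ?_)
    · exact mul_le_mul_of_nonneg_right (pow_le_pow_left₀ ha (le_max_left _ _) 2) (by positivity)
    · exact mul_le_mul_of_nonneg_right (pow_le_pow_left₀ hb (le_max_right _ _) 2) (by positivity)
  · simpa [norm_sq_sum_dirSum_apply] using
      sum_norm_sq_le_norm_blockOp (fun i j => dirSum (a i j) (b i j)) fun j => .toLp 2 (x j, 0)
  · simpa [norm_sq_sum_dirSum_apply] using
      sum_norm_sq_le_norm_blockOp (fun i j => dirSum (a i j) (b i j)) fun j => .toLp 2 (0, x j)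

end BlockOperators

section RowAndColumn

variable {n : ℕ}

/-- The norm of a matrix over `ℓ₂` when `ℓ₂` is realised as the row space. -/
noncomputable def rowNorm (v : Matrix (Fin n) (Fin n) Ell2) : ℝ := ‖blockOp (v.map rowOp)‖

/-- The norm of a matrix over `ℓ₂` when `ℓ₂` is realised as the column space. -/
noncomputable def colNorm (v : Matrix (Fin n) (Fin n) Ell2) : ℝ := ‖blockOp (v.map colOp)‖

theorem rowNorm_nonneg (v : Matrix (Fin n) (Fin n) Ell2) : 0 ≤ rowNorm v := norm_nonneg _

theorem colNorm_nonneg (v : Matrix (Fin n) (Fin n) Ell2) : 0 ≤ colNorm v := norm_nonneg _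

theorem sum_norm_sq_le_colNorm (v : Matrix (Fin n) (Fin n) Ell2) (z : Fin n → ℂ) :
    ∑ i, ‖∑ j, z j • v i j‖ ^ 2 ≤ colNorm v ^ 2 * ∑ j, ‖z j‖ ^ 2 := by
  simpa [colOp_apply, colNorm] using
    sum_norm_sq_le_norm_blockOp (v.map colOp) fun j => lp.single 2 0 (z j)

theorem colNorm_le {v : Matrix (Fin n) (Fin n) Ell2} {c : ℝ} (hc : 0 ≤ c)
    (h : ∀ z : Fin n → ℂ, ∑ i, ‖∑ j, z j • v i j‖ ^ 2 ≤ c ^ 2 * ∑ j, ‖z j‖ ^ 2) :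
    colNorm v ≤ c := by
  refine norm_blockOp_le hc fun x => ?_
  simp only [Matrix.map_apply, colOp_apply]
  refine (h fun j => x j 0).trans ?_
  gcongr with j
  exact lp.norm_apply_le_norm two_ne_zero (x j) 0

theorem colNorm_add_le (v w : Matrix (Fin n) (Fin n) Ell2) :
    colNorm (v + w) ≤ colNorm v + colNorm w := by
  have map_add : (v + w).map colOp = v.map colOp + w.map colOp :=
    Matrix.map_add _ (fun ξ η => by ext; simp [colOp_apply]) v w
  rw [colNorm, map_add]
  exact norm_blockOp_add_le _ _

theorem colNorm_map_le (T : Ell2 →L[ℂ] Ell2) (v : Matrix (Fin n) (Fin n) Ell2) :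
    colNorm (v.map T) ≤ ‖T‖ * colNorm v := by
  refine colNorm_le (mul_nonneg (norm_nonneg _) (colNorm_nonneg v)) fun z => ?_
  calc ∑ i, ‖∑ j, z j • v.map T i j‖ ^ 2
      = ∑ i, ‖T (∑ j, z j • v i j)‖ ^ 2 := by simp
    _ ≤ ∑ i, (‖T‖ * ‖∑ j, z j • v i j‖) ^ 2 := by
        gcongr
        exact T.le_opNorm _
    _ ≤ ‖T‖ ^ 2 * (colNorm v ^ 2 * ∑ j, ‖z j‖ ^ 2) := by
        simp only [mul_pow, ← Finset.mul_sum]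
        gcongr
        exact sum_norm_sq_le_colNorm v z
    _ = (‖T‖ * colNorm v) ^ 2 * ∑ j, ‖z j‖ ^ 2 := by ring

theorem colNorm_map_star (v : Matrix (Fin n) (Fin n) Ell2) : colNorm (v.map star) = colNorm v := by
  have map_star_le (w : Matrix (Fin n) (Fin n) Ell2) : colNorm (w.map star) ≤ colNorm w := by
    refine colNorm_le (colNorm_nonneg w) fun z => ?_
    have sum_star (i) : ∑ j, z j • w.map star i j = star (∑ j, star (z j) • w i j) := by
      rw [star_sum]
      simp only [star_smul, star_star, Matrix.map_apply]
    have norm_sum (i) : ‖∑ j, z j • w.map star i j‖ = ‖∑ j, star (z j) • w i j‖ := by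
      rw [sum_star, norm_star]
    have h := sum_norm_sq_le_colNorm w fun j => star (z j)
    simp only [norm_star] at h
    simp only [norm_sum]
    exact h
  have map_star_star : (v.map star).map star = v := by
    ext1 i j
    exact star_star (v i j)
  refine (map_star_le v).antisymm ?_
  have h := map_star_le (v.map star)
  rwa [map_star_star] at h

theorem adjoint_rowOp (ξ : Ell2) : ContinuousLinearMap.adjoint (rowOp ξ) = colOp (star ξ) := by
  refine ((ContinuousLinearMap.eq_adjoint_iff _ _).2 fun x y => ?_).symm
  simp [rowOp, colOp, inner_smul_left, inner_smul_right, mul_comm]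

theorem rowNorm_eq_colNorm_transpose (v : Matrix (Fin n) (Fin n) Ell2) :
    rowNorm v = colNorm v.transpose := by
  have conjTranspose_eq : (v.map rowOp).conjTranspose = (v.transpose.map star).map colOp := by
    ext1 i j
    exact adjoint_rowOp (v j i)
  rw [rowNorm, ← norm_blockOp_conjTranspose, conjTranspose_eq]
  exact colNorm_map_star v.transpose

theorem rowNorm_map_le (T : Ell2 →L[ℂ] Ell2) (v : Matrix (Fin n) (Fin n) Ell2) :
    rowNorm (v.map T) ≤ ‖T‖ * rowNorm v := by
  simpa only [rowNorm_eq_colNorm_transpose, Matrix.transpose_map] using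
    colNorm_map_le T v.transpose

theorem sum_norm_inner_sq_le_rowNorm (v : Matrix (Fin n) (Fin n) Ell2) (z : Fin n → ℂ)
    (x : Ell2) :
    ∑ i, ‖(inner ℂ x (∑ j, z j • v i j) : ℂ)‖ ^ 2 ≤
      rowNorm v ^ 2 * (∑ j, ‖z j‖ ^ 2) * ‖x‖ ^ 2 := by
  have inner_star_star (ξ : Ell2) : inner ℂ (star ξ) (star x) = inner ℂ x ξ := by
    simp [lp.inner_eq_tsum, mul_comm]
  simpa [rowNorm, rowOp, inner_star_star, inner_sum, inner_smul_right, ← Finset.sum_smul,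
    ← smul_assoc, norm_smul, mul_pow, ← Finset.sum_mul, mul_assoc] using
    sum_norm_sq_le_norm_blockOp (v.map rowOp) fun j => z j • star x

theorem hasSum_norm_sq {ι : Type*} (ξ : lp (fun _ : ι => ℂ) 2) :
    HasSum (fun i => ‖ξ i‖ ^ 2) (‖ξ‖ ^ 2) := by
  simpa using lp.hasSum_norm (p := 2) (by simp) ξ

/-- An operator on `ℓ₂` is row-to-column bounded if it is completely bounded as a map from the
row space to the column space. -/
def RowColBounded (D : Ell2 →L[ℂ] Ell2) : Prop :=
  ∃ c : ℝ, ∀ (n : ℕ) (v : Matrix (Fin n) (Fin n) Ell2), colNorm (v.map D) ≤ c * rowNorm v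

theorem RowColBounded.add {D E : Ell2 →L[ℂ] Ell2} (hD : RowColBounded D) (hE : RowColBounded E) :
    RowColBounded (D + E) := by
  obtain ⟨c, hc⟩ := hD
  obtain ⟨d, hd⟩ := hE
  refine ⟨c + d, fun n v => ?_⟩
  calc colNorm (v.map (D + E)) ≤ colNorm (v.map D) + colNorm (v.map E) :=
        colNorm_add_le (v.map D) (v.map E)
    _ ≤ (c + d) * rowNorm v := by
        rw [add_mul]
        exact add_le_add (hc n v) (hd n v)

theorem RowColBounded.comp_left {D : Ell2 →L[ℂ] Ell2} (hD : RowColBounded D)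
    (T : Ell2 →L[ℂ] Ell2) : RowColBounded (T ∘L D) := by
  obtain ⟨c, hc⟩ := hD
  refine ⟨‖T‖ * c, fun n v => (colNorm_map_le T (v.map D)).trans ?_⟩
  rw [mul_assoc]
  exact mul_le_mul_of_nonneg_left (hc n v) (norm_nonneg T)

theorem rowColBounded_of_summable_norm_sq_adjoint {D : Ell2 →L[ℂ] Ell2}
    (hD : Summable fun k : ℕ =>
      ‖ContinuousLinearMap.adjoint D (lp.single 2 k (1 : ℂ))‖ ^ 2) : RowColBounded D := by
  refine ⟨√(∑' k : ℕ, ‖ContinuousLinearMap.adjoint D (lp.single 2 k (1 : ℂ))‖ ^ 2), fun n v =>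
    colNorm_le (mul_nonneg (Real.sqrt_nonneg _) (rowNorm_nonneg v)) fun z => ?_⟩
  rw [mul_pow, Real.sq_sqrt (tsum_nonneg fun _ => sq_nonneg _), mul_assoc, mul_comm]
  have sum_map (i) : ∑ j, z j • v.map D i j = D (∑ j, z j • v i j) := by simp
  have apply_eq (k : ℕ) (ξ : Ell2) :
      D ξ k = inner ℂ (ContinuousLinearMap.adjoint D (lp.single 2 k (1 : ℂ))) ξ := by
    simp [ContinuousLinearMap.adjoint_inner_left, lp.inner_single_left]
  simp only [sum_map]
  refine hasSum_le (fun k => ?_) (hasSum_sum fun i _ => hasSum_norm_sq (D (∑ j, z j • v i j)))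
    (hD.hasSum.mul_left _)
  simpa only [apply_eq] using sum_norm_inner_sq_le_rowNorm v z _

theorem norm_sq_sum_smul_of_orthonormal {𝕜 E ι : Type*} [RCLike 𝕜] [NormedAddCommGroup E]
    [InnerProductSpace 𝕜 E] [Fintype ι] {g : ι → E} (hg : Orthonormal 𝕜 g) (z : ι → 𝕜) :
    ‖∑ j, z j • g j‖ ^ 2 = ∑ j, ‖z j‖ ^ 2 := by
  have h := hg.inner_sum z z Finset.univ
  simp only [inner_self_eq_norm_sq_to_K, RCLike.conj_mul] at h
  exact_mod_cast h

theorem colNorm_updateCol_zero (k : Fin n) (g : Fin n → Ell2) :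
    colNorm (Matrix.updateCol 0 k g) = √(∑ i, ‖g i‖ ^ 2) := by
  have sum_smul (z : Fin n → ℂ) (i) : ∑ j, z j • Matrix.updateCol 0 k g i j = z k • g i := by
    simp [Matrix.updateCol_apply]
  refine le_antisymm (colNorm_le (Real.sqrt_nonneg _) fun z => ?_) ?_
  · rw [Real.sq_sqrt (by positivity)]
    simp only [sum_smul, norm_smul, mul_pow, ← Finset.mul_sum]
    rw [mul_comm]
    gcongr
    exact Finset.single_le_sum (f := fun j => ‖z j‖ ^ 2) (fun _ _ => by positivity)
      (Finset.mem_univ k)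
  · refine Real.sqrt_le_iff.2 ⟨colNorm_nonneg _, ?_⟩
    have sum_single : ∑ j, ‖Pi.single (M := fun _ => ℂ) k 1 j‖ ^ 2 = 1 := by
      rw [Finset.sum_eq_single k (fun j _ hj => by simp [hj]) (by simp)]
      simp
    simpa only [sum_smul, Pi.single_eq_same, one_smul, sum_single, mul_one] using
      sum_norm_sq_le_colNorm (Matrix.updateCol 0 k g) (Pi.single k 1)

theorem rowNorm_updateCol_zero_le_one (k : Fin n) {g : Fin n → Ell2} (hg : Orthonormal ℂ g) :
    rowNorm (Matrix.updateCol 0 k g) ≤ 1 := by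
  rw [rowNorm_eq_colNorm_transpose, ← Matrix.updateRow_transpose, Matrix.transpose_zero]
  refine colNorm_le zero_le_one fun z => ?_
  rw [Finset.sum_eq_single k (fun i _ hi => by simp [Matrix.updateRow_ne hi]) (by simp)]
  simp only [Matrix.updateRow_self, norm_sq_sum_smul_of_orthonormal hg, one_pow, one_mul, le_refl]

end RowAndColumn

section CompleteIsomorphisms

variable {H K : Type*} [NormedAddCommGroup H] [InnerProductSpace ℂ H]
  [NormedAddCommGroup K] [InnerProductSpace ℂ K] {X : OperatorSpace H} {Y : OperatorSpace K}

theorem CompletelyIsomorphic.symm (h : CompletelyIsomorphic X Y) : CompletelyIsomorphic Y X := by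
  obtain ⟨u, hu, hu_symm⟩ := h
  exact ⟨u.symm, hu_symm, hu⟩

theorem CompletelyIsomorphic.completelyEmbeds (h : CompletelyIsomorphic X Y) :
    CompletelyEmbeds X Y :=
  ⟨Y, le_rfl, h⟩

theorem completelyIsomorphic_of_range_eq {V : Type*} [AddCommGroup V] [Module ℂ V]
    {F : V →ₗ[ℂ] (H →L[ℂ] H)} {G : V →ₗ[ℂ] (K →L[ℂ] K)}
    (hF : Function.Injective F) (hG : Function.Injective G)
    (hX : X.toSubmodule = LinearMap.range F) (hY : Y.toSubmodule = LinearMap.range G)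
    (hFG : ∃ c : ℝ, ∀ (n : ℕ) (w : Matrix (Fin n) (Fin n) V),
      ‖blockOp (w.map G)‖ ≤ c * ‖blockOp (w.map F)‖)
    (hGF : ∃ c : ℝ, ∀ (n : ℕ) (w : Matrix (Fin n) (Fin n) V),
      ‖blockOp (w.map F)‖ ≤ c * ‖blockOp (w.map G)‖) :
    CompletelyIsomorphic X Y := by
  let e := (LinearEquiv.ofInjective F hF).trans (LinearEquiv.ofEq _ _ hX.symm)
  let f := (LinearEquiv.ofInjective G hG).trans (LinearEquiv.ofEq _ _ hY.symm)
  have apply_e_symm (x) : F (e.symm x) = x := congrArg Subtype.val (e.apply_symm_apply x)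
  have apply_f_symm (x) : G (f.symm x) = x := congrArg Subtype.val (f.apply_symm_apply x)
  obtain ⟨c, hc⟩ := hFG
  obtain ⟨d, hd⟩ := hGF
  refine ⟨e.symm.trans f, ⟨c, fun n v => ?_⟩, ⟨d, fun n v => ?_⟩⟩
  · have map_map : (v.map e.symm).map F = v.map (fun x => (x : H →L[ℂ] H)) :=
      Matrix.ext fun _ _ => apply_e_symm _
    have h := hc n (v.map e.symm)
    rw [map_map] at h
    exact h
  · have map_map : (v.map f.symm).map G = v.map (fun x => (x : K →L[ℂ] K)) :=
      Matrix.ext fun _ _ => apply_f_symm _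
    have h := hd n (v.map f.symm)
    rw [map_map] at h
    exact h

end CompleteIsomorphisms

section GraphSpaces

variable {A B : Ell2 →L[ℂ] Ell2}

theorem norm_blockOp_graphMap (A : Ell2 →L[ℂ] Ell2) {n : ℕ}
    (w : Matrix (Fin n) (Fin n) Ell2) :
    ‖blockOp (w.map (graphMap A))‖ = max (rowNorm w) (colNorm (w.map A)) :=
  norm_blockOp_dirSum (w.map rowOp) ((w.map A).map colOp)

theorem norm_blockOp_graphMap_comp (A T : Ell2 →L[ℂ] Ell2) {n : ℕ}
    (w : Matrix (Fin n) (Fin n) Ell2) :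
    ‖blockOp (w.map (graphMap A ∘ₗ T.toLinearMap))‖ =
      max (rowNorm (w.map T)) (colNorm (w.map (A ∘L T))) := by
  have map_comp : w.map (graphMap A ∘ₗ T.toLinearMap) = (w.map T).map (graphMap A) :=
    Matrix.ext fun i j => LinearMap.comp_apply (graphMap A) T.toLinearMap (w i j)
  have map_map : (w.map T).map A = w.map (A ∘L T) := Matrix.ext fun _ _ => rfl
  rw [map_comp, norm_blockOp_graphMap, map_map]

theorem exists_max_rowNorm_colNorm_le {S T P G : Ell2 →L[ℂ] Ell2}
    (hPS : P ∘L S = .id ℂ Ell2) (h : RowColBounded (B - G ∘L A)) :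
    ∃ c : ℝ, ∀ (n : ℕ) (w : Matrix (Fin n) (Fin n) Ell2),
      max (rowNorm (w.map T)) (colNorm (w.map B)) ≤
        c * max (rowNorm (w.map S)) (colNorm (w.map A)) := by
  obtain ⟨r, hr⟩ := h
  refine ⟨max (‖T‖ * ‖P‖) (|r| * ‖P‖ + ‖G‖), fun n w => ?_⟩
  set N := max (rowNorm (w.map S)) (colNorm (w.map A))
  have zero_le_N : 0 ≤ N := (rowNorm_nonneg _).trans (le_max_left _ _)
  have rowNorm_le : rowNorm w ≤ ‖P‖ * N := by
    have map_map : (w.map S).map P = w := Matrix.ext fun i j => DFunLike.congr_fun hPS (w i j)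
    calc rowNorm w = rowNorm ((w.map S).map P) := by rw [map_map]
      _ ≤ ‖P‖ * rowNorm (w.map S) := rowNorm_map_le P _
      _ ≤ ‖P‖ * N := mul_le_mul_of_nonneg_left (le_max_left _ _) (norm_nonneg P)
  refine max_le ?_ ?_
  · calc rowNorm (w.map T) ≤ ‖T‖ * rowNorm w := rowNorm_map_le T w
      _ ≤ ‖T‖ * (‖P‖ * N) := mul_le_mul_of_nonneg_left rowNorm_le (norm_nonneg T)
      _ = ‖T‖ * ‖P‖ * N := (mul_assoc _ _ _).symm
      _ ≤ _ := mul_le_mul_of_nonneg_right (le_max_left _ _) zero_le_N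
  · have map_eq : w.map B = w.map (B - G ∘L A) + (w.map A).map G :=
      Matrix.ext fun i j => (sub_add_cancel (B (w i j)) (G (A (w i j)))).symm
    calc colNorm (w.map B) ≤ colNorm (w.map (B - G ∘L A)) + colNorm ((w.map A).map G) := by
          rw [map_eq]
          exact colNorm_add_le _ _
      _ ≤ r * rowNorm w + ‖G‖ * colNorm (w.map A) := add_le_add (hr n w) (colNorm_map_le G _)
      _ ≤ |r| * (‖P‖ * N) + ‖G‖ * N := by
          gcongr
          · exact rowNorm_nonneg w
          · exact le_abs_self r
          · exact le_max_right _ _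
      _ = (|r| * ‖P‖ + ‖G‖) * N := by ring
      _ ≤ _ := mul_le_mul_of_nonneg_right (le_max_right _ _) zero_le_N

theorem graphMap_injective (A : Ell2 →L[ℂ] Ell2) : Function.Injective (graphMap A) := by
  refine (injective_iff_map_eq_zero _).2 fun ξ hξ => norm_le_zero_iff.1 ?_
  simpa [hξ] using norm_le_norm_graphMap A ξ

theorem completelyIsomorphic_graphSpace {G G' : Ell2 →L[ℂ] Ell2}
    (hBA : RowColBounded (B - G ∘L A)) (hAB : RowColBounded (A - G' ∘L B)) :
    CompletelyIsomorphic (graphSpace A) (graphSpace B) := by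
  refine completelyIsomorphic_of_range_eq (graphMap_injective A) (graphMap_injective B) rfl rfl
    ?_ ?_
  · simpa only [norm_blockOp_graphMap, ContinuousLinearMap.coe_id', Matrix.map_id] using
      exists_max_rowNorm_colNorm_le (T := .id ℂ Ell2) (ContinuousLinearMap.id_comp _) hBA
  · simpa only [norm_blockOp_graphMap, ContinuousLinearMap.coe_id', Matrix.map_id] using
      exists_max_rowNorm_colNorm_le (T := .id ℂ Ell2) (ContinuousLinearMap.id_comp _) hAB

theorem antilipschitzWith_graphMap_comp (B : Ell2 →L[ℂ] Ell2) {T L : Ell2 →L[ℂ] Ell2}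
    (hLT : L ∘L T = .id ℂ Ell2) : AntilipschitzWith ‖L‖₊ (graphMap B ∘ₗ T.toLinearMap) :=
  AddMonoidHomClass.antilipschitz_of_bound _ fun ξ =>
    calc ‖ξ‖ = ‖L (T ξ)‖ := congrArg norm (DFunLike.congr_fun hLT ξ).symm
      _ ≤ ‖L‖ * ‖T ξ‖ := L.le_opNorm _
      _ ≤ ‖L‖ * ‖graphMap B (T ξ)‖ :=
        mul_le_mul_of_nonneg_left (norm_le_norm_graphMap B _) (norm_nonneg L)

theorem completelyEmbeds_graphSpace {T L : Ell2 →L[ℂ] Ell2} (hLT : L ∘L T = .id ℂ Ell2)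
    (h : RowColBounded (A - B ∘L T)) : CompletelyEmbeds (graphSpace A) (graphSpace B) := by
  let F := graphMap B ∘ₗ T.toLinearMap
  have hF := antilipschitzWith_graphMap_comp B hLT
  have uniformContinuous_F : UniformContinuous F :=
    uniformContinuous_addMonoidHom_of_continuous ((continuous_graphMap B).comp T.continuous)
  refine ⟨⟨LinearMap.range F, hF.isClosed_range uniformContinuous_F⟩,
    LinearMap.range_comp_le_range _ _,
    completelyIsomorphic_of_range_eq (graphMap_injective A) hF.injective rfl rfl ?_ ?_⟩
  · have neg_comp : (-ContinuousLinearMap.id ℂ Ell2) ∘L (A - B ∘L T) =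
        B ∘L T - ContinuousLinearMap.id ℂ Ell2 ∘L A := by
      simp only [ContinuousLinearMap.neg_comp, ContinuousLinearMap.id_comp, neg_sub]
    have neg_bounded := h.comp_left (-ContinuousLinearMap.id ℂ Ell2)
    rw [neg_comp] at neg_bounded
    simpa only [F, norm_blockOp_graphMap, norm_blockOp_graphMap_comp,
      ContinuousLinearMap.coe_id', Matrix.map_id] using
      exists_max_rowNorm_colNorm_le (ContinuousLinearMap.id_comp _) neg_bounded
  · simpa only [F, norm_blockOp_graphMap, norm_blockOp_graphMap_comp,
      ContinuousLinearMap.coe_id', Matrix.map_id] using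
      exists_max_rowNorm_colNorm_le (T := .id ℂ Ell2) (G := .id ℂ Ell2) hLT
        (by simpa only [ContinuousLinearMap.id_comp] using h)

theorem CompletelyBounded.exists_clm {Z : OperatorSpace (WithLp 2 (Ell2 × Ell2))}
    (hZ : Z ≤ graphSpace B) {u : (graphSpace A).toSubmodule →ₗ[ℂ] Z.toSubmodule}
    (hu : CompletelyBounded (graphSpace A) Z u) :
    ∃ T : Ell2 →L[ℂ] Ell2, ∀ ξ, (u ((graphMap A).rangeRestrict ξ) :
      WithLp 2 (Ell2 × Ell2) →L[ℂ] WithLp 2 (Ell2 × Ell2)) = graphMap B (T ξ) := by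
  obtain ⟨C, hC⟩ := hu
  let A' : Ell2 →L[ℂ] _ := ⟨graphMap A, continuous_graphMap A⟩
  let e := LinearEquiv.ofInjective (graphMap B) (graphMap_injective B)
  let T₀ : Ell2 →ₗ[ℂ] Ell2 := e.symm.toLinearMap ∘ₗ Submodule.inclusion hZ ∘ₗ u ∘ₗ
    (graphMap A).rangeRestrict
  have graphMap_T₀ (ξ) : graphMap B (T₀ ξ) = u ((graphMap A).rangeRestrict ξ) :=
    congrArg Subtype.val
      (e.apply_symm_apply (Submodule.inclusion hZ (u ((graphMap A).rangeRestrict ξ))))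
  refine ⟨T₀.mkContinuous (|C| * ‖A'‖) fun ξ => ?_, fun ξ => (graphMap_T₀ ξ).symm⟩
  let v : Matrix (Fin 1) (Fin 1) (graphSpace A).toSubmodule :=
    fun _ _ => (graphMap A).rangeRestrict ξ
  calc ‖T₀ ξ‖ ≤ ‖graphMap B (T₀ ξ)‖ := norm_le_norm_graphMap B _
    _ = matNorm Z (v.map u) := by
        rw [graphMap_T₀]
        exact (norm_blockOp_fin_one ((v.map u).map fun x => x.1)).symm
    _ ≤ C * matNorm (graphSpace A) v := hC 1 v
    _ = C * ‖A' ξ‖ := congrArg (C * ·) (norm_blockOp_fin_one _)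
    _ ≤ |C| * (‖A'‖ * ‖ξ‖) :=
        mul_le_mul (le_abs_self C) (A'.le_opNorm ξ) (norm_nonneg _) (abs_nonneg C)
    _ = |C| * ‖A'‖ * ‖ξ‖ := (mul_assoc _ _ _).symm

end GraphSpaces

section CompleteEmbeddings

variable {A B : Ell2 →L[ℂ] Ell2}

theorem CompletelyEmbeds.exists_max_rowNorm_colNorm_le
    (h : CompletelyEmbeds (graphSpace A) (graphSpace B)) :
    ∃ (T : Ell2 →L[ℂ] Ell2) (c : ℝ), ∀ (n : ℕ) (w : Matrix (Fin n) (Fin n) Ell2),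
      max (rowNorm w) (colNorm (w.map A)) ≤
        c * max (rowNorm (w.map T)) (colNorm (w.map (B ∘L T))) := by
  obtain ⟨Z, hZ, u, hu, c, hc⟩ := h
  obtain ⟨T, hT⟩ := CompletelyBounded.exists_clm hZ hu
  refine ⟨T, c, fun n w => ?_⟩
  let v : Matrix (Fin n) (Fin n) Z.toSubmodule := w.map fun ξ => u ((graphMap A).rangeRestrict ξ)
  have map_symm : (v.map u.symm).map (fun x => x.1) = w.map (graphMap A) :=
    Matrix.ext fun i j =>
      congrArg Subtype.val (u.symm_apply_apply ((graphMap A).rangeRestrict (w i j)))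
  have map_coe : v.map (fun x => x.1) = w.map (graphMap B ∘ₗ T.toLinearMap) :=
    Matrix.ext fun i j => hT (w i j)
  have h := hc n v
  simp only [matNorm] at h
  rw [← norm_blockOp_graphMap, ← norm_blockOp_graphMap_comp, ← map_symm, ← map_coe]
  exact h

theorem CompletelyEmbeds.exists_sum_norm_sq_le
    (h : CompletelyEmbeds (graphSpace A) (graphSpace B)) :
    ∃ T : Ell2 →L[ℂ] Ell2, ∀ (n : ℕ) (g : Fin n → Ell2), Orthonormal ℂ g →
      ∑ i, ‖A (g i)‖ ^ 2 ≤ ‖T‖ ^ 2 + ∑ i, ‖B (T (g i))‖ ^ 2 := by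
  obtain ⟨T, c, hT⟩ := h.exists_max_rowNorm_colNorm_le
  refine ⟨(c : ℂ) • T, fun n g hg => ?_⟩
  obtain _ | ⟨⟨k⟩⟩ := isEmpty_or_nonempty (Fin n)
  · simp
  let w : Matrix (Fin n) (Fin n) Ell2 := Matrix.updateCol 0 k g
  have colNorm_map_sq (D : Ell2 →L[ℂ] Ell2) :
      colNorm (w.map D) ^ 2 = ∑ i, ‖D (g i)‖ ^ 2 := by
    rw [Matrix.map_updateCol D, Matrix.map_zero _ (map_zero D), colNorm_updateCol_zero,
      Real.sq_sqrt (by positivity)]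
    rfl
  have rowNorm_map_sq_le : rowNorm (w.map T) ^ 2 ≤ ‖T‖ ^ 2 :=
    pow_le_pow_left₀ (rowNorm_nonneg _) ((rowNorm_map_le T _).trans
      (mul_le_of_le_one_right (norm_nonneg T) (rowNorm_updateCol_zero_le_one k hg))) 2
  have max_sq_le {a b : ℝ} : max a b ^ 2 ≤ a ^ 2 + b ^ 2 := by
    rcases max_choice a b with h | h <;> rw [h] <;> linarith [sq_nonneg a, sq_nonneg b]
  calc ∑ i, ‖A (g i)‖ ^ 2 = colNorm (w.map A) ^ 2 :=
        (colNorm_map_sq A).symm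
    _ ≤ (c * max (rowNorm (w.map T))
          (colNorm (w.map (B ∘L T)))) ^ 2 :=
        pow_le_pow_left₀ (colNorm_nonneg _) ((le_max_right _ _).trans (hT n _)) 2
    _ ≤ c ^ 2 * (‖T‖ ^ 2 + ∑ i, ‖(B ∘L T) (g i)‖ ^ 2) := by
        rw [mul_pow, ← colNorm_map_sq (B ∘L T)]
        gcongr
        exact max_sq_le.trans (by gcongr)
    _ = ‖(c : ℂ) • T‖ ^ 2 + ∑ i, ‖B (((c : ℂ) • T) (g i))‖ ^ 2 := by
        simp only [norm_smul, smul_apply, ContinuousLinearMap.comp_apply,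
          map_smul, Complex.norm_real, Real.norm_eq_abs, mul_pow, sq_abs, mul_add, Finset.mul_sum]

end CompleteEmbeddings

section DiagonalOperators

variable {D E : Ell2 →L[ℂ] Ell2} {d e : ℕ → ℝ}

/-- `D` acts on `ℓ₂` as the diagonal matrix with real diagonal entries `d i`. -/
def HasDiagonal (D : Ell2 →L[ℂ] Ell2) (d : ℕ → ℝ) : Prop := ∀ ξ i, D ξ i = d i * ξ i

theorem hasDiagonal_diagOp (α : ℕ → unitInterval) :
    HasDiagonal (diagOp α) fun i => (α i : ℝ) := diagOp_apply α

theorem exists_hasDiagonal {c : ℝ} (hd : ∀ i, |d i| ≤ c) : ∃ D, HasDiagonal D d :=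
  ⟨lp.mapCLM 2 (fun i => (d i : ℂ) • ContinuousLinearMap.id ℂ ℂ) ((abs_nonneg (d 0)).trans (hd 0))
    fun i => by simpa [norm_smul] using hd i, fun ξ i => by simp⟩

theorem HasDiagonal.ext (hD : HasDiagonal D d) (hE : HasDiagonal E d) : D = E :=
  ContinuousLinearMap.ext fun ξ => lp.ext (funext fun i => (hD ξ i).trans (hE ξ i).symm)

theorem HasDiagonal.comp (hD : HasDiagonal D d) (hE : HasDiagonal E e) :
    HasDiagonal (D ∘L E) fun i => d i * e i := fun ξ i => by
  rw [ContinuousLinearMap.comp_apply, hD, hE, Complex.ofReal_mul, mul_assoc]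

theorem HasDiagonal.comp_comm (hD : HasDiagonal D d) (hE : HasDiagonal E e) :
    D ∘L E = E ∘L D :=
  (hD.comp hE).ext (by simpa only [mul_comm] using hE.comp hD)

theorem HasDiagonal.sub (hD : HasDiagonal D d) (hE : HasDiagonal E e) :
    HasDiagonal (D - E) fun i => d i - e i := fun ξ i => by
  rw [sub_apply, lp.coeFn_sub, Pi.sub_apply, hD, hE, Complex.ofReal_sub, sub_mul]

theorem HasDiagonal.norm_sq_apply_le (hD : HasDiagonal D d) {c : ℝ} {ξ : Ell2}
    (h : ∀ i, ξ i ≠ 0 → |d i| ≤ c) : ‖D ξ‖ ^ 2 ≤ c ^ 2 * ‖ξ‖ ^ 2 := by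
  refine hasSum_le (fun i => ?_) (hasSum_norm_sq _) ((hasSum_norm_sq ξ).mul_left _)
  rw [hD, norm_mul, mul_pow, Complex.norm_real, Real.norm_eq_abs]
  by_cases hi : ξ i = 0
  · simp [hi]
  · gcongr
    exact h i hi

theorem HasDiagonal.le_norm_sq_apply (hD : HasDiagonal D d) {c : ℝ} (hc : 0 ≤ c) {ξ : Ell2}
    (h : ∀ i, ξ i ≠ 0 → c ≤ |d i|) : c ^ 2 * ‖ξ‖ ^ 2 ≤ ‖D ξ‖ ^ 2 := by
  refine hasSum_le (fun i => ?_) ((hasSum_norm_sq ξ).mul_left _) (hasSum_norm_sq _)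
  rw [hD, norm_mul, mul_pow, Complex.norm_real, Real.norm_eq_abs]
  by_cases hi : ξ i = 0
  · simp [hi]
  · gcongr
    exact h i hi

theorem HasDiagonal.adjoint_eq (hD : HasDiagonal D d) : ContinuousLinearMap.adjoint D = D :=
  ((ContinuousLinearMap.eq_adjoint_iff _ _).2 fun ξ η => by
    simp [lp.inner_eq_tsum, hD _ _, mul_left_comm, mul_assoc]).symm

theorem HasDiagonal.apply_single (hD : HasDiagonal D d) (k : ℕ) :
    D (lp.single 2 k (1 : ℂ)) = lp.single 2 k (d k : ℂ) := by
  refine lp.ext (funext fun i => ?_)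
  obtain rfl | hi := eq_or_ne i k
  · simp [hD _ _]
  · simp [hD _ _, hi]

theorem HasDiagonal.rowColBounded (hD : HasDiagonal D d) (hd : Summable fun i => d i ^ 2) :
    RowColBounded D :=
  rowColBounded_of_summable_norm_sq_adjoint <| by
    simpa [hD.adjoint_eq, hD.apply_single, lp.norm_single] using hd

theorem HasDiagonal.exists_rowColBounded_sub_comp (hD : HasDiagonal D d) (hE : HasDiagonal E e)
    {U : Set ℕ} (hU : Summable fun i : U => d i ^ 2) {c : ℝ} (h : ∀ i ∉ U, |d i| ≤ c * |e i|) :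
    ∃ G g, HasDiagonal G g ∧ (∀ i ∈ U, g i = 0) ∧ RowColBounded (D - E ∘L G) := by
  let g : ℕ → ℝ := Uᶜ.indicator fun i => d i / e i
  have abs_g_le (i) : |g i| ≤ |c| := by
    by_cases hi : i ∈ U
    · simp [g, hi]
    · simpa [g, hi, abs_div] using div_le_of_le_mul₀ (abs_nonneg (e i)) (abs_nonneg c)
        ((h i hi).trans (mul_le_mul_of_nonneg_right (le_abs_self c) (abs_nonneg (e i))))
  have sq_sub_eq_indicator :
      (fun i => (d i - e i * g i) ^ 2) = U.indicator fun i => d i ^ 2 := by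
    ext i
    by_cases hi : i ∈ U
    · simp [g, hi]
    · have d_eq_zero (he : e i = 0) : d i = 0 := by simpa [he] using h i hi
      simp [g, hi, mul_div_cancel_of_imp' d_eq_zero]
  obtain ⟨G, hG⟩ := exists_hasDiagonal abs_g_le
  refine ⟨G, g, hG, fun i hi => by simp [g, hi], (hD.sub (hE.comp hG)).rowColBounded ?_⟩
  rw [sq_sub_eq_indicator]
  exact summable_subtype_iff_indicator.1 hU

end DiagonalOperators

section ZeroExtension

variable {ι κ : Type*} (σ : ι ↪ κ)

theorem hasSum_norm_sq_extend (ξ : lp (fun _ : ι => ℂ) 2) :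
    HasSum (fun k => ‖Function.extend σ ξ 0 k‖ ^ 2) (‖ξ‖ ^ 2) := by
  have extend_norm_sq : (fun k => ‖Function.extend σ ξ 0 k‖ ^ 2) =
      Function.extend σ (fun i => ‖ξ i‖ ^ 2) 0 := by
    ext k
    rw [Function.apply_extend (fun z : ℂ => ‖z‖ ^ 2)]
    congr
    ext
    simp
  rw [extend_norm_sq]
  exact (hasSum_extend_zero σ.injective).2 (hasSum_norm_sq ξ)

/-- The isometric embedding of `ℓ₂(ι)` into `ℓ₂(κ)` that relabels coordinates along `σ : ι ↪ κ` and
puts zeros outside the range of `σ`. -/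
noncomputable def zeroExtension : lp (fun _ : ι => ℂ) 2 →ₗᵢ[ℂ] lp (fun _ : κ => ℂ) 2 where
  toFun ξ := ⟨Function.extend σ ξ 0, memℓp_gen <| by
    simpa using (hasSum_norm_sq_extend σ ξ).summable⟩
  map_add' ξ η := lp.ext <| by
    have h := Function.extend_add σ ξ η 0 0
    rw [add_zero] at h
    exact h
  map_smul' c ξ := lp.ext <| by
    simpa using Function.extend_smul (f := σ) c ξ 0
  norm_map' ξ := (sq_eq_sq₀ (norm_nonneg _) (norm_nonneg _)).1
    ((hasSum_norm_sq _).unique (hasSum_norm_sq_extend σ ξ))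

@[simp]
theorem zeroExtension_apply (ξ : lp (fun _ : ι => ℂ) 2) (i : ι) :
    zeroExtension σ ξ (σ i) = ξ i :=
  σ.injective.extend_apply ξ 0 i

theorem zeroExtension_apply_of_notMem_range (ξ : lp (fun _ : ι => ℂ) 2) {k : κ}
    (hk : k ∉ Set.range σ) : zeroExtension σ ξ k = 0 :=
  Function.extend_apply' _ _ _ hk

theorem adjoint_zeroExtension_apply (ξ : lp (fun _ : κ => ℂ) 2) (i : ι) :
    ContinuousLinearMap.adjoint (zeroExtension σ).toContinuousLinearMap ξ i = ξ (σ i) := by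
  classical
  have zeroExtension_single : zeroExtension σ (lp.single 2 i 1) = lp.single 2 (σ i) 1 := by
    refine lp.ext (funext fun k => ?_)
    by_cases hk : k ∈ Set.range σ
    · obtain ⟨j, rfl⟩ := hk
      simp [Pi.single_apply]
    · rw [zeroExtension_apply_of_notMem_range σ _ hk, lp.single_apply_ne]
      rintro rfl
      exact hk ⟨i, rfl⟩
  have h := ContinuousLinearMap.adjoint_inner_right (zeroExtension σ).toContinuousLinearMap
    (lp.single 2 i 1) ξ
  simpa [zeroExtension_single, lp.inner_single_left] using h

theorem diagOp_comp_zeroExtension (σ : ℕ ↪ ℕ) (β : ℕ → unitInterval) :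
    diagOp β ∘L (zeroExtension σ).toContinuousLinearMap =
      (zeroExtension σ).toContinuousLinearMap ∘L diagOp (β ∘ σ) := by
  refine ContinuousLinearMap.ext fun ξ => lp.ext (funext fun k => ?_)
  by_cases hk : k ∈ Set.range σ
  · obtain ⟨i, rfl⟩ := hk
    simp [diagOp_apply]
  · simp [diagOp_apply, zeroExtension_apply_of_notMem_range σ _ hk]

end ZeroExtension

section Domination

variable {α β : ℕ → unitInterval}

theorem summable_sq_union {S R : Set ℕ} {c : ℝ} (hS : Summable fun i : S => (α i : ℝ) ^ 2)
    (hR : Summable fun i : R => (β i : ℝ) ^ 2) (h : ∀ i ∉ S, (α i : ℝ) ≤ c * β i) :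
    Summable fun i : ↑(S ∪ R) => (α i : ℝ) ^ 2 := by
  have summable_diff : Summable fun i : ↑(R \ S) => (α i : ℝ) ^ 2 :=
    .of_nonneg_of_le (fun _ => sq_nonneg _)
      (fun i => (pow_le_pow_left₀ (α i).2.1 (h i i.2.2) 2).trans_eq (mul_pow _ _ _))
      ((hR.comp_injective (Set.inclusion_injective Set.sdiff_subset)).mul_left (c ^ 2))
  rw [← Set.union_sdiff_self]
  exact (hS.hasSum.add_disjoint (f := fun i => (α i : ℝ) ^ 2) Set.disjoint_sdiff_right
    summable_diff.hasSum).summable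

theorem exists_embedding_summable_sq (hβ : Tendsto (fun i => (β i : ℝ)) atTop (𝓝 0)) :
    ∃ σ : ℕ ↪ ℕ, Summable fun i => (β (σ i) : ℝ) ^ 2 := by
  obtain ⟨σ, hσ, hσβ⟩ := extraction_forall_of_eventually
    (P := fun n k => (β k : ℝ) < (1 / 2) ^ n) fun n => hβ.eventually_lt_const (by positivity)
  refine ⟨⟨σ, hσ.injective⟩,
    summable_geometric_two.of_nonneg_of_le (fun _ => sq_nonneg _) fun i => ?_⟩
  exact (pow_le_of_le_one (β (σ i)).2.1 (β (σ i)).2.2 two_ne_zero).trans (hσβ i).le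

theorem completelyEmbeds_of_seqDominated (hβ : Tendsto (fun i => (β i : ℝ)) atTop (𝓝 0))
    (h : SeqDominated α β) : CompletelyEmbeds (diagSpace α) (diagSpace β) := by
  obtain ⟨S, c, -, hS, hαβ⟩ := h
  obtain ⟨σ, hσ⟩ := exists_embedding_summable_sq hβ
  have hα_union : Summable fun i : ↑(S ∪ Set.range σ) => (α i : ℝ) ^ 2 :=
    summable_sq_union hS ((Equiv.ofInjective σ σ.injective).summable_iff.1 hσ) hαβ
  obtain ⟨G, g, hG, hgU, hGβ⟩ := (hasDiagonal_diagOp α).exists_rowColBounded_sub_comp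
    (hasDiagonal_diagOp β) hα_union fun i hi => by
      simpa only [abs_of_nonneg (unitInterval.nonneg _)] using hαβ i (hi ∘ .inl)
  let V : Ell2 →L[ℂ] Ell2 := (zeroExtension σ).toContinuousLinearMap
  have adjoint_comp : V.adjoint ∘L (G + V) = .id ℂ Ell2 := by
    refine ContinuousLinearMap.ext fun ξ => lp.ext (funext fun i => ?_)
    have g_eq_zero : g (σ i) = 0 := hgU _ (.inr ⟨i, rfl⟩)
    simp [V, adjoint_zeroExtension_apply, hG _ _, g_eq_zero]
  have comp_add : diagOp α - diagOp β ∘L (G + V) =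
      (diagOp α - diagOp β ∘L G) + (-V) ∘L diagOp (β ∘ σ) := by
    rw [ContinuousLinearMap.comp_add, diagOp_comp_zeroExtension, ContinuousLinearMap.neg_comp]
    abel
  refine completelyEmbeds_graphSpace adjoint_comp ?_
  rw [comp_add]
  exact hGβ.add (((hasDiagonal_diagOp _).rowColBounded hσ).comp_left (-V))

theorem completelyIsomorphic_of_seqEquiv (h : SeqEquiv α β) :
    CompletelyIsomorphic (diagSpace α) (diagSpace β) := by
  obtain ⟨⟨S, c, -, hS, hβα⟩, ⟨S', c', -, hS', hαβ⟩⟩ := h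
  obtain ⟨G, _, hG, -, hGα⟩ := (hasDiagonal_diagOp β).exists_rowColBounded_sub_comp
    (hasDiagonal_diagOp α) hS fun i hi => by
      simpa only [abs_of_nonneg (unitInterval.nonneg _)] using hβα i hi
  obtain ⟨G', _, hG', -, hGβ⟩ := (hasDiagonal_diagOp α).exists_rowColBounded_sub_comp
    (hasDiagonal_diagOp β) hS' fun i hi => by
      simpa only [abs_of_nonneg (unitInterval.nonneg _)] using hαβ i hi
  rw [(hasDiagonal_diagOp α).comp_comm hG] at hGα
  rw [(hasDiagonal_diagOp β).comp_comm hG'] at hGβ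
  exact completelyIsomorphic_graphSpace hGα hGβ

theorem sum_sq_sub_le_of_antitone (hα : Antitone α) (hβ : Antitone β) {T : Ell2 →L[ℂ] Ell2}
    {c : ℝ} (hT : ∀ (n : ℕ) (g : Fin n → Ell2), Orthonormal ℂ g →
      ∑ i, ‖diagOp α (g i)‖ ^ 2 ≤ c + ∑ i, ‖diagOp β (T (g i))‖ ^ 2) (s : Finset ℕ) :
    ∑ i ∈ s, ((α i : ℝ) ^ 2 - ‖T‖ ^ 2 * (β i : ℝ) ^ 2) ≤ c := by
  obtain ⟨n, hn⟩ := s.exists_nat_subset_range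
  let J : EuclideanSpace ℂ (Fin n) →ₗᵢ[ℂ] Ell2 :=
    (zeroExtension Fin.valEmbedding).comp (lpPiLpₗᵢ (fun _ => ℂ) ℂ).symm.toLinearIsometry
  let J' : EuclideanSpace ℂ (Fin n) →L[ℂ] Ell2 := J.toContinuousLinearMap
  let ψ : Ell2 →ₗ[ℂ] Fin n → ℂ := LinearMap.pi fun i => lp.evalₗ (fun _ : ℕ => ℂ) 2 (i : ℕ)
  rw [← Finset.map_valEmbedding_attachFin fun i hi => Finset.mem_range.1 (hn hi), Finset.sum_map]
  refine sum_sub_le_of_orthonormalBasis finrank_euclideanSpace_fin (A := diagOp α ∘L J')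
    (B := diagOp β ∘L T ∘L J') (a := fun i => (α i : ℝ) ^ 2)
    (b := fun i => ‖T‖ ^ 2 * (β i : ℝ) ^ 2) (ψ ∘ₗ J.toLinearMap) (ψ ∘ₗ (T ∘L J').toLinearMap)
    (fun i x hx => ?_) (fun i x hx => ?_) (fun e t => ?_) (s.attachFin _)
  · have J_apply_eq_zero (j : ℕ) (hj : i < j) : J x j = 0 := by
      by_cases hjn : j < n
      · exact hx ⟨j, hjn⟩ hj
      · exact zeroExtension_apply_of_notMem_range _ _ (by simpa using hjn)
    rw [← J.norm_map x]
    refine (hasDiagonal_diagOp α).le_norm_sq_apply (α i).2.1 fun j hj => ?_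
    rw [abs_of_nonneg (α j).2.1]
    exact hα (not_lt.1 (mt (J_apply_eq_zero j) hj))
  · have norm_sq_le : ‖T (J x)‖ ^ 2 ≤ ‖T‖ ^ 2 * ‖x‖ ^ 2 := by
      rw [← mul_pow, ← J.norm_map x]
      exact pow_le_pow_left₀ (norm_nonneg _) (T.le_opNorm _) 2
    calc ‖diagOp β (T (J x))‖ ^ 2 ≤ (β i : ℝ) ^ 2 * ‖T (J x)‖ ^ 2 := by
          refine (hasDiagonal_diagOp β).norm_sq_apply_le fun j hj => ?_
          rw [abs_of_nonneg (β j).2.1]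
          exact hβ (not_lt.1 fun hji => hj (hx ⟨j, hji.trans i.2⟩ hji))
      _ ≤ (β i : ℝ) ^ 2 * (‖T‖ ^ 2 * ‖x‖ ^ 2) := by gcongr
      _ = ‖T‖ ^ 2 * (β i : ℝ) ^ 2 * ‖x‖ ^ 2 := by ring
  · have orthonormal_J : Orthonormal ℂ fun k => J (e (t.equivFin.symm k)) :=
      (e.orthonormal.comp_linearIsometry J).comp _
        (Subtype.val_injective.comp t.equivFin.symm.injective)
    have sum_eq (f : Fin n → ℝ) : ∑ k, f (t.equivFin.symm k) = ∑ p ∈ t, f p :=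
      (t.equivFin.symm.sum_comp fun p => f p).trans (t.sum_coe_sort f)
    rw [← sum_eq, ← sum_eq]
    exact hT _ _ orthonormal_J

theorem seqDominated_of_sum_sq_sub_le {c K : ℝ} (hK : 0 ≤ K)
    (h : ∀ s : Finset ℕ, ∑ i ∈ s, ((α i : ℝ) ^ 2 - K * (β i : ℝ) ^ 2) ≤ c) :
    SeqDominated α β := by
  refine ⟨{i | 2 * K * (β i : ℝ) ^ 2 < (α i : ℝ) ^ 2}, √(2 * K) + 1, by positivity,
    summable_of_sum_le (c := 2 * c) (fun _ => sq_nonneg _) fun s => ?_, fun i hi => ?_⟩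
  · calc ∑ i ∈ s, (α i : ℝ) ^ 2 ≤ ∑ i ∈ s, 2 * ((α i : ℝ) ^ 2 - K * (β i : ℝ) ^ 2) :=
          Finset.sum_le_sum fun i _ => by linarith [Set.mem_ofPred.1 i.2]
      _ = 2 * ∑ i ∈ s.map (.subtype _), ((α i : ℝ) ^ 2 - K * (β i : ℝ) ^ 2) := by
          rw [Finset.sum_map, Finset.mul_sum]
          rfl
      _ ≤ 2 * c := by gcongr; exact h _
  · have sq_le : (α i : ℝ) ^ 2 ≤ (√(2 * K) * β i) ^ 2 := by
      rw [mul_pow, Real.sq_sqrt (by positivity)]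
      exact not_lt.1 hi
    have hβi : (0 : ℝ) ≤ β i := (β i).2.1
    linarith [le_of_sq_le_sq sq_le (by positivity)]

theorem seqDominated_of_completelyEmbeds (hα : Antitone α) (hβ : Antitone β)
    (h : CompletelyEmbeds (diagSpace α) (diagSpace β)) : SeqDominated α β := by
  obtain ⟨T, hT⟩ := h.exists_sum_norm_sq_le
  exact seqDominated_of_sum_sq_sub_le (sq_nonneg ‖T‖) (sum_sq_sub_le_of_antitone hα hβ hT)

end Domination

end OperatorSpace

theorem mainTheorem2_general {α β : ℕ → unitInterval} (hα : Antitone α) (hβ : Antitone β) :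
    (Tendsto (fun i => (β i : ℝ)) atTop (𝓝 0) →
      (OperatorSpace.CompletelyEmbeds (OperatorSpace.diagSpace α) (OperatorSpace.diagSpace β) ↔
        SeqDominated α β)) ∧
    [OperatorSpace.CompletelyIsomorphic (OperatorSpace.diagSpace α) (OperatorSpace.diagSpace β),
      OperatorSpace.CompletelyEmbeds (OperatorSpace.diagSpace α) (OperatorSpace.diagSpace β) ∧
        OperatorSpace.CompletelyEmbeds (OperatorSpace.diagSpace β) (OperatorSpace.diagSpace α),
      SeqEquiv α β].TFAE := by
  refine ⟨fun hβ_lim => ⟨OperatorSpace.seqDominated_of_completelyEmbeds hα hβ,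
    OperatorSpace.completelyEmbeds_of_seqDominated hβ_lim⟩, ?_⟩
  tfae_have 1 → 2 := fun h => ⟨h.completelyEmbeds, h.symm.completelyEmbeds⟩
  tfae_have 2 → 3 := fun h => ⟨OperatorSpace.seqDominated_of_completelyEmbeds hβ hα h.2,
    OperatorSpace.seqDominated_of_completelyEmbeds hα hβ h.1⟩
  tfae_have 3 → 1 := OperatorSpace.completelyIsomorphic_of_seqEquiv
  tfae_finish

theorem mainTheorem2 (α β : ℕ → unitInterval) (hα : α ∈ nullSequences) (hβ : β ∈ nullSequences) :
    (OperatorSpace.CompletelyEmbeds (OperatorSpace.diagSpace α) (OperatorSpace.diagSpace β) ↔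
      SeqDominated α β) ∧
    [OperatorSpace.CompletelyIsomorphic (OperatorSpace.diagSpace α) (OperatorSpace.diagSpace β),
      OperatorSpace.CompletelyEmbeds (OperatorSpace.diagSpace α) (OperatorSpace.diagSpace β) ∧
        OperatorSpace.CompletelyEmbeds (OperatorSpace.diagSpace β) (OperatorSpace.diagSpace α),
      SeqEquiv α β].TFAE :=
  (mainTheorem2_general hα.1 hβ.1).imp_left fun h => h hβ.2
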